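/- Let $f_2(x)=\prod_{n\ge 0}\bigl(1-x^{-2^n}\bigr)\in\mathbb{Q}((x^{-1}))$ and $g_2(x)=x^{-1}f_2(x)$. For $t\ge 0$ let $p_t(x)/q_t(x)=[a_0(x);a_1(x),\dots,a_t(x)]$, written in reduced form, be the $t$-th convergent of the continued fraction expansion $g_2(x)=[a_0(x);a_1(x),a_2(x),\dots]$ with $a_i\in\mathbb{Q}[x]$; the pair $(p_t,q_t)$ is determined up to a common factor in $\mathbb{Q}\setminus\{0\}$, and it is normalised (in any way) so that $q_t\in\mathbb{Z}[x]$. For an integer $m\ge 1$ and an integer $b$ coprime to $m$, let $\Gamma(b,m)$ be the subgroup of $(\mathbb{Z}/m\mathbb{Z})^*$ generated by the class of $b$. Let $a\ge 2$ be an integer. Suppose that there are an odd prime $p$ and integers $n_0,t\ge 0$ such that 1. $p$ divides $a^{2^{n_0}}-1$, but $p^2$ does not; 2. $|\Gamma(2,p^2)|=p\,|\Gamma(2,p)|$; 3. $q_t\bigl(a^{2^{n_0}}\bigr)\equiv 0\pmod{p^2}$; 4. $q_t'(1)\not\equiv 0\pmod p$. Then the real number $f_2(a)=\prod_{n\ge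 0}\bigl(1-a^{-2^n}\bigr)$ is not badly approximable; that is, there is no constant $c>0$ such that $|f_2(a)-r/s|\ge c/s^2$ for all integers $r,s$ with $s\ne 0$. -/

import Mathlib

open Polynomial

noncomputable section

namespace ThueMorse

/-! ### The field `ℚ((x⁻¹))`

An element of `LaurentSeries ℚ` is read as a Laurent series in `x⁻¹`: its coefficient of index `i`
is the coefficient of `x ^ (-i)`. -/

/-- The element `x` of `ℚ((x⁻¹))`. -/
def xL : LaurentSeries ℚ := HahnSeries.single (-1) 1

/-- The inclusion of `ℚ[x]` into `ℚ((x⁻¹))`. -/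
def ofPoly (P : ℚ[X]) : LaurentSeries ℚ := Polynomial.aeval xL P

/-- The polynomial part of a Laurent series in `x⁻¹`. -/
def polyPart (u : LaurentSeries ℚ) : ℚ[X] :=
  ∑ i ∈ Finset.range ((-u.order).toNat + 1), Polynomial.monomial i (u.coeff (-(i : ℤ)))

theorem coeff_polyPart (u : LaurentSeries ℚ) (n : ℕ) :
    (polyPart u).coeff n = u.coeff (-(n : ℤ)) := by
  simp only [polyPart, Polynomial.finsetSum_coeff, Polynomial.coeff_monomial,
    Finset.sum_ite_eq', Finset.mem_range]
  split_ifs with h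
  · rfl
  · exact (HahnSeries.coeff_eq_zero_of_lt_order (by omega)).symm

/-! ### Continued fractions in `ℚ((x⁻¹))` -/

/-- The complete quotients `u₀ = u`, `uₙ₊₁ = 1 / (uₙ - aₙ)`, where `aₙ` is the polynomial part
of `uₙ`. -/
def completeQuotient (u : LaurentSeries ℚ) : ℕ → LaurentSeries ℚ
  | 0 => u
  | n + 1 => (completeQuotient u n - ofPoly (polyPart (completeQuotient u n)))⁻¹

/-- The partial quotients `aₙ` of `u`. -/
def partialQuotient (u : LaurentSeries ℚ) (n : ℕ) : ℚ[X] :=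
  polyPart (completeQuotient u n)

/-- The finite continued fraction `[a₀; a₁, …, aₙ]`. -/
def finiteContFrac : (ℕ → ℚ[X]) → ℕ → RatFunc ℚ
  | a, 0 => algebraMap ℚ[X] (RatFunc ℚ) (a 0)
  | a, n + 1 =>
      algebraMap ℚ[X] (RatFunc ℚ) (a 0) + (finiteContFrac (fun i => a (i + 1)) n)⁻¹

/-- `P / Q` is a reduced form of the `n`-th convergent of `u`. The pair `(P, Q)` is determined by
`u` and `n` up to a common non-zero constant factor. -/
def IsConvergent (u : LaurentSeries ℚ) (n : ℕ) (P Q : ℚ[X]) : Prop :=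
  Q ≠ 0 ∧ IsCoprime P Q ∧
    algebraMap ℚ[X] (RatFunc ℚ) P / algebraMap ℚ[X] (RatFunc ℚ) Q =
      finiteContFrac (partialQuotient u) n

/-! ### Generalized Thue–Morse functions and their values -/

section
open scoped PowerSeries.WithPiTopology

/-- `∏_{t ≥ 0} (1 - y ^ (d ^ t))` as a formal power series in `y = x⁻¹` (the infinite product is
the one for coefficientwise convergence). -/
def fPower (d : ℕ) : PowerSeries ℚ := ∏' t : ℕ, (1 - (PowerSeries.X : PowerSeries ℚ) ^ d ^ t)

theorem multipliable_fPower {d : ℕ} (hd : 2 ≤ d) :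
    Multipliable fun t : ℕ => 1 - (PowerSeries.X : PowerSeries ℚ) ^ d ^ t := by
  simp only [sub_eq_add_neg]
  apply PowerSeries.WithPiTopology.multipliable_one_add_of_tendsto_order_atTop_nhds_top
  simp only [PowerSeries.order_neg, PowerSeries.order_X_pow]
  exact ENat.tendsto_natCast_nhds_top.comp (tendsto_pow_atTop_atTop_of_one_lt (by omega))

end

/-- The series `f_d(x) = ∏_{t ≥ 0} (1 - x ^ (-d ^ t))` in `ℚ((x⁻¹))`. -/
def fSeries (d : ℕ) : LaurentSeries ℚ := HahnSeries.ofPowerSeries ℤ ℚ (fPower d)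

/-- The series `g_d(x) = x ^ (-d + 1) f_d(x)` in `ℚ((x⁻¹))`. -/
def gSeries (d : ℕ) : LaurentSeries ℚ := xL ^ (-(d : ℤ) + 1) * fSeries d

/-- The real number `f_d(a) = ∏_{t ≥ 0} (1 - a ^ (-d ^ t))`. -/
def fValue (d : ℕ) (a : ℝ) : ℝ := ∏' t : ℕ, (1 - (a ^ d ^ t)⁻¹)

theorem multipliable_fValue {d : ℕ} (hd : 2 ≤ d) {a : ℝ} (ha : 1 < a) :
    Multipliable fun t : ℕ => 1 - (a ^ d ^ t)⁻¹ := by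
  simp only [sub_eq_add_neg]
  apply Real.multipliable_one_add_of_summable
  apply Summable.neg
  simp only [← inv_pow]
  exact (summable_geometric_of_lt_one (by positivity) (inv_lt_one_of_one_lt₀ ha)).comp_injective
    (Nat.pow_right_injective hd)

/-! ### Arithmetic notions -/

/-- A real number `x` is badly approximable if `0 < |x - p / q|` and `|x - p / q| ≥ c / q ^ 2` for
some `c > 0` and all integers `p`, `q` with `q ≠ 0`. -/
def BadlyApproximable (x : ℝ) : Prop :=
  ∃ c : ℝ, 0 < c ∧ ∀ p q : ℤ, q ≠ 0 →
    0 < |x - (p : ℝ) / (q : ℝ)| ∧ c / (q : ℝ) ^ 2 ≤ |x - (p : ℝ) / (q : ℝ)|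

/-- For `a` coprime to `n`, the subgroup `Γ(a, n)` of `(ℤ/nℤ)ˣ` generated by the class of `a`. -/
def Gam (a : ℤ) (n : ℕ) : Subgroup (ZMod n)ˣ :=
  Subgroup.closure {u : (ZMod n)ˣ | (u : ZMod n) = (a : ZMod n)}

end ThueMorse

end

namespace ThueMorse

/-! ### Powers of two and roots of polynomials modulo prime powers -/

/-! With `x = a ^ 2 ^ n` and `A = ∏_{t < n} (a ^ 2 ^ t - 1)`, the product formula gives `f₂(a) = A a
g₂(x)`. For the fixed convergent `P / Q` of `g₂`, the fraction `A a P(x) / Q(x)` is then within `O(1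
/ Q(x) ^ 2)` of `f₂(a)`, because `A a ≤ x` and `Q(x) = O(x ^ deg Q)`. If `p ^ e` divides both `A`
and `Q(x)`, cancelling it makes error times squared denominator `O(p ^ (-2e))`, which rules out
every `c` (`not_badlyApproximable_of_forall_exists_dvd`).

Such `n` exist for every `e`. The factors of `A` with `t ≥ n₀` are all divisible by `p`. For `Q(x)`,
put `Y = a ^ 2 ^ n₀`: as 2 is not a Wieferich base for `p`, repeated squaring moves `Y` through all
lifts of its class modulo `p ^ (e + 2)` to classes modulo `p ^ (e + 3)`. Since `Q'(Y) ≡ Q'(1)` is a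
unit modulo `p`, one of these lifts is a root (`exists_dvd_eval_pow_two_pow`), and this iterates. -/

theorem not_sq_dvd_two_pow_sub_one {p : ℕ} (hp : p.Prime) (hodd : Odd p)
    (h : Nat.card (Gam 2 (p ^ 2)) = p * Nat.card (Gam 2 p)) :
    ¬ (p : ℤ) ^ 2 ∣ 2 ^ (p - 1) - 1 := by
  intro hd
  have hcop : Nat.Coprime 2 (p ^ 2) := (Nat.coprime_two_left.mpr hodd).pow_right 2
  have : NeZero (p ^ 2) := ⟨pow_ne_zero 2 hp.ne_zero⟩
  have : NeZero p := ⟨hp.ne_zero⟩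
  set u : (ZMod (p ^ 2))ˣ := ZMod.unitOfCoprime 2 hcop with hu
  have hGam : Gam 2 (p ^ 2) = Subgroup.zpowers u := by
    rw [Subgroup.zpowers_eq_closure, Gam]
    congr 1
    ext v
    simp [hu, Units.ext_iff]
  have hone : u ^ (p - 1) = 1 := by
    ext
    have h0 := (ZMod.intCast_zmod_eq_zero_iff_dvd (2 ^ (p - 1) - 1) (p ^ 2)).mpr
      (by exact_mod_cast hd)
    push_cast at h0
    simpa [hu, sub_eq_zero] using h0
  have hle : orderOf u ≤ p - 1 := orderOf_le_of_pow_eq_one (Nat.sub_pos_of_lt hp.one_lt) hone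
  rw [hGam, Nat.card_zpowers] at h
  have hpos : 0 < Nat.card (Gam 2 p) := Nat.card_pos
  have := Nat.le_mul_of_pos_right p hpos
  have := hp.pos
  omega

theorem emultiplicity_eq_one_iff {p x : ℤ} : emultiplicity p x = 1 ↔ p ∣ x ∧ ¬ p ^ 2 ∣ x := by
  have := emultiplicity_eq_coe (a := p) (b := x) (n := 1)
  simpa using this

theorem not_dvd_of_dvd_sub_one {p : ℕ} (hp : p.Prime) {Y : ℤ} (h : (p : ℤ) ∣ Y - 1) :
    ¬ (p : ℤ) ∣ Y := fun hY =>
  (Nat.prime_iff_prime_int.mp hp).not_dvd_one (by simpa using dvd_sub hY h)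

theorem emultiplicity_pow_sub_one {p : ℕ} (hp : p.Prime) (hodd : Odd p) {Y : ℤ}
    (h : (p : ℤ) ∣ Y - 1) (n : ℕ) :
    emultiplicity (p : ℤ) (Y ^ n - 1) = emultiplicity (p : ℤ) (Y - 1) + emultiplicity p n := by
  simpa using Int.emultiplicity_pow_sub_pow hp hodd (y := 1) h (not_dvd_of_dvd_sub_one hp h) n

/-- Lifting the exponent from `2 ^ (p - 1) - 1`, whose valuation is exactly 1. -/
theorem emultiplicity_two_pow_sub_one {p : ℕ} (hp : p.Prime) (hodd : Odd p)
    (h : ¬ (p : ℤ) ^ 2 ∣ 2 ^ (p - 1) - 1) (e : ℕ) :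
    emultiplicity p (2 ^ ((p - 1) * p ^ e) - 1) = (e + 1 : ℕ) := by
  have hd : (p : ℤ) ∣ 2 ^ (p - 1) - 1 :=
    (Int.ModEq.pow_card_sub_one_eq_one hp
      (by exact_mod_cast (Nat.coprime_two_left.mpr hodd).isCoprime)).symm.dvd
  have h1 := emultiplicity_pow_sub_one hp hodd hd (p ^ e)
  rw [emultiplicity_eq_one_iff.mpr ⟨hd, h⟩, emultiplicity_pow_self hp.ne_zero hp.prime.not_isUnit,
    ← pow_mul] at h1
  rw [← Int.natCast_emultiplicity, Nat.cast_sub Nat.one_le_two_pow]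
  push_cast
  rw [h1, add_comm]

theorem sq_dvd_one_add_pow_sub {R : Type*} [CommRing R] (x : R) (n : ℕ) :
    x ^ 2 ∣ (1 + x) ^ n - (1 + n * x) := by
  induction n with
  | zero => simp
  | succ n ih =>
    obtain ⟨k, hk⟩ := ih
    refine ⟨k * (1 + x) + n, ?_⟩
    rw [pow_succ, sub_eq_iff_eq_add.mp hk]
    push_cast
    ring

/-- One step of Hensel lifting for a root of `Q` modulo `p ^ N`, inside the orbit of `Y` under
repeated squaring. -/
theorem exists_dvd_eval_pow_two_pow {p : ℕ} (hp : p.Prime) (hodd : Odd p)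
    (h2 : ¬ (p : ℤ) ^ 2 ∣ 2 ^ (p - 1) - 1) {Q : ℤ[X]} (hQ : ¬ (p : ℤ) ∣ Q.derivative.eval 1)
    {Y : ℤ} (hY : (p : ℤ) ∣ Y - 1) (hY2 : ¬ (p : ℤ) ^ 2 ∣ Y - 1) {e : ℕ}
    (hroot : (p : ℤ) ^ (e + 2) ∣ Q.eval Y) :
    ∃ j, 1 ≤ j ∧ (p : ℤ) ^ (e + 3) ∣ Q.eval (Y ^ 2 ^ j) := by
  have hpi : Prime (p : ℤ) := Nat.prime_iff_prime_int.mp hp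
  have : Fact p.Prime := ⟨hp⟩
  -- With this `m`, squaring `m` times fixes `Y` modulo `p ^ (e + 2)` but not modulo `p ^ (e + 3)`.
  set m := (p - 1) * p ^ e with hm
  have hmpos : 1 ≤ m := Nat.mul_pos (Nat.sub_pos_of_lt hp.one_lt) (pow_pos hp.pos e)
  have hmult : emultiplicity (p : ℤ) (Y ^ (2 ^ m - 1) - 1) = (e + 2 : ℕ) := by
    rw [emultiplicity_pow_sub_one hp hodd hY, emultiplicity_eq_one_iff.mpr ⟨hY, hY2⟩,
      emultiplicity_two_pow_sub_one hp hodd h2]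
    push_cast
    ring
  obtain ⟨⟨c, hc⟩, hnd⟩ := emultiplicity_eq_coe.mp hmult
  have hc' : ¬ (p : ℤ) ∣ c := fun ⟨k, hk⟩ => hnd ⟨k, by rw [hc, hk]; ring⟩
  obtain ⟨q₀, hq₀⟩ := hroot
  have hder : ¬ (p : ℤ) ∣ Q.derivative.eval Y := fun h =>
    hQ ((dvd_sub_right h).mp (hY.trans (Polynomial.sub_dvd_eval_sub Y 1 _)))
  have hYd := not_dvd_of_dvd_sub_one hp hY
  -- choose `j` with `q₀ + Q'(Y) c j Y ≡ 0 (mod p)`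
  obtain ⟨j, hj1, hj⟩ : ∃ j : ℕ, 1 ≤ j ∧ (p : ℤ) ∣ q₀ + Q.derivative.eval Y * (c * j * Y) := by
    have hne : ((Q.derivative.eval Y * c * Y : ℤ) : ZMod p) ≠ 0 := by
      rw [Ne, ZMod.intCast_zmod_eq_zero_iff_dvd]
      exact fun h => (hpi.dvd_or_dvd h).elim
        (fun h => (hpi.dvd_or_dvd h).elim hder hc') hYd
    -- Adding `p` forces `1 ≤ j` without changing the residue.
    refine ⟨(-(q₀ : ZMod p) / (Q.derivative.eval Y * c * Y : ℤ)).val + p,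
      le_add_left hp.one_le, ?_⟩
    rw [← ZMod.intCast_zmod_eq_zero_iff_dvd]
    push_cast at hne ⊢
    rw [ZMod.natCast_val, ZMod.cast_id', id, ZMod.natCast_self, add_zero]
    linear_combination mul_div_cancel₀ (-(q₀ : ZMod p)) hne
  refine ⟨m * j, Nat.mul_pos hmpos hj1, ?_⟩
  -- `2 ^ (m j) - 1 = (2 ^ m - 1) S` with `S ≡ j (mod p)`
  set S := ∑ i ∈ Finset.range j, (2 ^ m) ^ i with hS
  have hSexp : 2 ^ (m * j) = (2 ^ m - 1) * S + 1 := by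
    have h := Nat.geomSum_eq (m := 2 ^ m) (Nat.one_lt_two_pow (by omega)) j
    have hdvd : 2 ^ m - 1 ∣ (2 ^ m) ^ j - 1 := by
      simpa using Nat.sub_dvd_pow_sub_pow (2 ^ m) 1 j
    rw [hS, h, Nat.mul_div_cancel' hdvd, ← pow_mul, Nat.sub_add_cancel Nat.one_le_two_pow]
  have hSj : (p : ℤ) ∣ (S : ℤ) - j := by
    have h1 : ((2 ^ m : ℕ) : ZMod p) = 1 := by
      have h2p : (2 : ZMod p) ≠ 0 := by
        have := (ZMod.isUnit_iff_coprime 2 p).mpr (Nat.coprime_two_left.mpr hodd)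
        exact_mod_cast this.ne_zero
      push_cast
      rw [hm, pow_mul, ZMod.pow_card_sub_one_eq_one h2p, one_pow]
    rw [← ZMod.intCast_zmod_eq_zero_iff_dvd, hS]
    push_cast at h1 ⊢
    simp [h1]
  obtain ⟨s, hs⟩ := hSj
  obtain ⟨k, hk⟩ := sq_dvd_one_add_pow_sub ((p : ℤ) ^ (e + 2) * c) S
  obtain ⟨z, hz⟩ : ∃ z, Y ^ 2 ^ (m * j) = Y + (p : ℤ) ^ (e + 2) * (c * j * Y + p * z) := by
    refine ⟨c * s * Y + p ^ (e + 1) * c ^ 2 * k * Y, ?_⟩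
    rw [hSexp, pow_succ, pow_mul, sub_eq_iff_eq_add.mp hc, add_comm _ (1 : ℤ),
      sub_eq_iff_eq_add.mp hk, sub_eq_iff_eq_add.mp hs]
    ring
  obtain ⟨r, hr⟩ :=
    Polynomial.binomExpansion Q Y ((p : ℤ) ^ (e + 2) * (c * j * Y + p * z))
  obtain ⟨l, hl⟩ := hj
  refine ⟨l + Q.derivative.eval Y * z + r * p ^ (e + 1) * (c * j * Y + p * z) ^ 2, ?_⟩
  rw [hz, hr, hq₀]
  linear_combination (p : ℤ) ^ (e + 2) * hl

theorem exists_dvd_eval_pow_two_pow_of_le {p : ℕ} (hp : p.Prime) (hodd : Odd p)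
    (h2 : ¬ (p : ℤ) ^ 2 ∣ 2 ^ (p - 1) - 1) {Q : ℤ[X]} (hQ : ¬ (p : ℤ) ∣ Q.derivative.eval 1)
    {Y : ℤ} (hY : (p : ℤ) ∣ Y - 1) (hY2 : ¬ (p : ℤ) ^ 2 ∣ Y - 1)
    (hroot : (p : ℤ) ^ 2 ∣ Q.eval Y) (e : ℕ) :
    ∃ k, e ≤ k ∧ (p : ℤ) ^ (e + 2) ∣ Q.eval (Y ^ 2 ^ k) := by
  induction e with
  | zero => exact ⟨0, le_rfl, by simpa using hroot⟩
  | succ e ih =>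
    obtain ⟨k, hk, hd⟩ := ih
    -- As `2 ^ k` is prime to `p`, `Y ^ 2 ^ k - 1` is again divisible by `p` exactly once, so the
    -- lifting step applies to it.
    have hcop : emultiplicity p (2 ^ k) = 0 :=
      emultiplicity_eq_zero.mpr fun h => by
        have := (Nat.prime_dvd_prime_iff_eq hp Nat.prime_two).mp (hp.dvd_of_dvd_pow h)
        subst this
        exact absurd hodd (by decide)
    have hmult := emultiplicity_pow_sub_one hp hodd hY (2 ^ k)
    rw [emultiplicity_eq_one_iff.mpr ⟨hY, hY2⟩, hcop, add_zero, emultiplicity_eq_one_iff] at hmult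
    obtain ⟨j, hj, hd'⟩ := exists_dvd_eval_pow_two_pow hp hodd h2 hQ hmult.1 hmult.2 hd
    exact ⟨k + j, by omega, by rwa [pow_add 2, pow_mul]⟩

/-! ### Approximation by convergents in `ℚ((x⁻¹))` -/

theorem ofPoly_zero : ofPoly 0 = 0 := map_zero _

theorem ofPoly_add (P Q : ℚ[X]) : ofPoly (P + Q) = ofPoly P + ofPoly Q := map_add _ _ _

theorem ofPoly_monomial (n : ℕ) (c : ℚ) :
    ofPoly (monomial n c) = HahnSeries.single (-(n : ℤ)) c := by
  have : algebraMap ℚ (LaurentSeries ℚ) c = HahnSeries.single 0 c := by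
    rw [eq_ratCast, ← HahnSeries.single_zero_ratCast, Rat.cast_id]
  rw [ofPoly, aeval_monomial, this, xL, HahnSeries.single_pow, HahnSeries.single_mul_single]
  simp

theorem coeff_ofPoly (P : ℚ[X]) (i : ℤ) :
    (ofPoly P).coeff i = if i ≤ 0 then P.coeff (-i).toNat else 0 := by
  induction P using Polynomial.induction_on' with
  | add P Q hP hQ =>
    rw [ofPoly_add, HahnSeries.coeff_add, hP, hQ]
    split_ifs <;> simp
  | monomial n c =>
    rw [ofPoly_monomial, HahnSeries.coeff_single, coeff_monomial]
    split_ifs <;> first | rfl | omega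

theorem ofPoly_mul (P Q : ℚ[X]) : ofPoly (P * Q) = ofPoly P * ofPoly Q := map_mul _ _ _

theorem ofPoly_ne_zero {P : ℚ[X]} (hP : P ≠ 0) : ofPoly P ≠ 0 := fun h => by
  have := coeff_ofPoly P (-(P.natDegree : ℤ))
  rw [h] at this
  exact hP (leadingCoeff_eq_zero.mp (by simpa using this.symm))

theorem order_ofPoly {P : ℚ[X]} (hP : P ≠ 0) : (ofPoly P).order = -(P.natDegree : ℤ) := by
  apply le_antisymm
  · apply HahnSeries.order_le_of_coeff_ne_zero
    simp [coeff_ofPoly, hP]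
  · by_contra! hlt
    refine HahnSeries.coeff_order_eq_zero.not.mpr (ofPoly_ne_zero hP) ?_
    rw [coeff_ofPoly, if_pos (by omega), Polynomial.coeff_eq_zero_of_natDegree_lt (by omega)]

theorem order_sub_polyPart_pos {u : LaurentSeries ℚ} (h : u - ofPoly (polyPart u) ≠ 0) :
    0 < (u - ofPoly (polyPart u)).order := by
  by_contra! hle
  refine HahnSeries.coeff_order_eq_zero.not.mpr h ?_
  rw [HahnSeries.coeff_sub, coeff_ofPoly, if_pos hle, coeff_polyPart, Int.toNat_of_nonneg (by omega),
    neg_neg, sub_self]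

theorem order_eq_of_order_lt_order_sub {x y : LaurentSeries ℚ} (hx : x ≠ 0)
    (h : x - y ≠ 0 → y.order < (x - y).order) (hy : y ≠ 0) : x.order = y.order := by
  by_cases hxy : x - y = 0
  · rw [sub_eq_zero.mp hxy]
  · have hlt : y.orderTop < (x - y).orderTop := by
      rw [← HahnSeries.order_eq_orderTop_of_ne_zero hy,
        ← HahnSeries.order_eq_orderTop_of_ne_zero hxy]
      exact_mod_cast h hxy
    have := HahnSeries.orderTop_add_eq_left hlt
    rw [add_sub_cancel, ← HahnSeries.order_eq_orderTop_of_ne_zero hy,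
      ← HahnSeries.order_eq_orderTop_of_ne_zero hx] at this
    exact_mod_cast this

theorem completeQuotient_succ (u : LaurentSeries ℚ) (n : ℕ) :
    completeQuotient u (n + 1) = completeQuotient (u - ofPoly (polyPart u))⁻¹ n := by
  induction n with
  | zero => rfl
  | succ n ih => rw [completeQuotient, ih, completeQuotient]

theorem finiteContFrac_partialQuotient_succ (u : LaurentSeries ℚ) (n : ℕ) :
    finiteContFrac (partialQuotient u) (n + 1) =
      algebraMap ℚ[X] (RatFunc ℚ) (polyPart u) +
        (finiteContFrac (partialQuotient (u - ofPoly (polyPart u))⁻¹) n)⁻¹ := by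
  have : (fun i => partialQuotient u (i + 1)) = partialQuotient (u - ofPoly (polyPart u))⁻¹ :=
    funext fun i => by rw [partialQuotient, completeQuotient_succ, partialQuotient]
  rw [finiteContFrac, this]
  rfl

/-- Induction by splitting off the first partial quotient: if `u = a₀ + 1 / v` and `(P, Q)` serves
`v`, then `(a₀ P + Q, P)` serves `u`. Its error times `v` is minus the old error, and `deg P = deg Q
- ord v`. -/
theorem exists_finiteContFrac_eq_div (u : LaurentSeries ℚ) (n : ℕ) :
    ∃ P Q : ℚ[X], Q ≠ 0 ∧
      algebraMap ℚ[X] (RatFunc ℚ) P / algebraMap ℚ[X] (RatFunc ℚ) Q =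
        finiteContFrac (partialQuotient u) n ∧
      (ofPoly Q * u - ofPoly P ≠ 0 → (Q.natDegree : ℤ) < (ofPoly Q * u - ofPoly P).order) := by
  have hone : ofPoly 1 = 1 := map_one _
  induction n generalizing u with
  | zero =>
    refine ⟨polyPart u, 1, one_ne_zero, by simp [finiteContFrac, partialQuotient,
      completeQuotient], ?_⟩
    rw [hone, one_mul, natDegree_one]
    exact order_sub_polyPart_pos
  | succ n ih =>
    set v := (u - ofPoly (polyPart u))⁻¹ with hv
    have hu : u = ofPoly (polyPart u) + v⁻¹ := by rw [hv, inv_inv]; ring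
    obtain ⟨P, Q, hQ, hfrac, hord⟩ := ih v
    have hQ' := ofPoly_ne_zero hQ
    rw [finiteContFrac_partialQuotient_succ, ← hv, ← hfrac]
    have hnv : v ≠ 0 → v.order < 0 := fun hv0 => by
      have hne : u - ofPoly (polyPart u) ≠ 0 := fun h => hv0 (by rw [hv, h, inv_zero])
      have h1 := order_sub_polyPart_pos hne
      have h2 := HahnSeries.order_mul hne hv0
      rw [hv, mul_inv_cancel₀ hne, HahnSeries.order_one, ← hv] at h2
      omega
    -- Here `v = 0`, so `u` is a polynomial and the expansion has stopped; the convention `0⁻¹ = 0`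
    -- keeps the convergent equal to `u`.
    by_cases hP : P = 0
    · refine ⟨polyPart u, 1, one_ne_zero, by simp [hP], ?_⟩
      have hv0 : v = 0 := by
        by_contra hv0
        rw [hP, ofPoly_zero, sub_zero] at hord
        have := hord (mul_ne_zero hQ' hv0)
        rw [HahnSeries.order_mul hQ' hv0, order_ofPoly hQ] at this
        have := hnv hv0
        omega
      intro h
      rw [hv0, inv_zero, add_zero] at hu
      rw [hone, one_mul, ← hu, sub_self] at h
      exact absurd rfl h
    · have hP' := ofPoly_ne_zero hP
      have hv0 : v ≠ 0 := by
        intro hv0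
        rw [hv0, mul_zero, zero_sub, HahnSeries.order_neg, order_ofPoly hP] at hord
        have := hord (neg_ne_zero.mpr hP')
        omega
      have hdeg : -(Q.natDegree : ℤ) + v.order = -(P.natDegree : ℤ) := by
        rw [← order_ofPoly hQ, ← order_ofPoly hP, ← HahnSeries.order_mul hQ' hv0]
        refine order_eq_of_order_lt_order_sub (mul_ne_zero hQ' hv0) (fun h => ?_) hP'
        have := hord h
        rw [order_ofPoly hP]
        omega
      refine ⟨polyPart u * P + Q, P, hP, ?_, ?_⟩
      · have := (map_ne_zero_iff _ (IsFractionRing.injective ℚ[X] (RatFunc ℚ))).mpr hP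
        rw [map_add, map_mul, inv_div, add_div, mul_div_cancel_right₀ _ this]
      · have herr : (ofPoly P * u - ofPoly (polyPart u * P + Q)) * v =
            -(ofPoly Q * v - ofPoly P) := by
          rw [ofPoly_add, ofPoly_mul]
          nth_rewrite 1 [hu]
          linear_combination ofPoly P * inv_mul_cancel₀ hv0
        intro hne
        have h1 := HahnSeries.order_mul hne hv0
        rw [herr, HahnSeries.order_neg] at h1
        have h2 := hord fun h => mul_ne_zero hne hv0 (by rw [herr, h, neg_zero])
        omega

/-- Cancelling a common factor `k` lowers the denominator degree by `deg k` and raises the order of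
the error by as much. -/
theorem IsConvergent.natDegree_lt_order {u : LaurentSeries ℚ} {n : ℕ} {P Q : ℚ[X]}
    (h : IsConvergent u n P Q) (hne : ofPoly Q * u - ofPoly P ≠ 0) :
    (Q.natDegree : ℤ) < (ofPoly Q * u - ofPoly P).order := by
  obtain ⟨hQ, hcop, hfrac⟩ := h
  obtain ⟨P₁, Q₁, hQ₁, hfrac₁, hord⟩ := exists_finiteContFrac_eq_div u n
  have hinj := IsFractionRing.injective ℚ[X] (RatFunc ℚ)
  have hcross : P * Q₁ = P₁ * Q := by
    rw [← hfrac₁, div_eq_div_iff ((map_ne_zero_iff _ hinj).mpr hQ)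
      ((map_ne_zero_iff _ hinj).mpr hQ₁), ← map_mul, ← map_mul] at hfrac
    exact hinj hfrac
  obtain ⟨k, rfl⟩ : Q ∣ Q₁ := hcop.symm.dvd_of_dvd_mul_left ⟨P₁, by rw [hcross, mul_comm]⟩
  have hk : k ≠ 0 := right_ne_zero_of_mul hQ₁
  obtain rfl : P₁ = P * k := mul_right_cancel₀ hQ (by rw [← hcross]; ring)
  have heq : ofPoly (Q * k) * u - ofPoly (P * k) = ofPoly k * (ofPoly Q * u - ofPoly P) := by
    rw [ofPoly_mul, ofPoly_mul]; ring
  have hk' := ofPoly_ne_zero hk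
  rw [heq, HahnSeries.order_mul hk' hne, order_ofPoly hk, natDegree_mul hQ hk] at hord
  have := hord (mul_ne_zero hk' hne)
  push_cast at this
  omega

theorem IsConvergent.coeff_eq_zero {u : LaurentSeries ℚ} {n : ℕ} {P Q : ℚ[X]}
    (h : IsConvergent u n P Q) {i : ℤ} (hi : i ≤ Q.natDegree) :
    (ofPoly Q * u - ofPoly P).coeff i = 0 := by
  by_cases hne : ofPoly Q * u - ofPoly P = 0
  · rw [hne, HahnSeries.coeff_zero]
  · exact HahnSeries.coeff_eq_zero_of_lt_order (hi.trans_lt (h.natDegree_lt_order hne))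

/-! ### Coefficients of `f₂` and its values -/

theorem coeff_prod_one_sub_X_pow_of_le {n m : ℕ} (h : 2 ^ n ≤ m) :
    PowerSeries.coeff m (∏ t ∈ Finset.range n, (1 - (PowerSeries.X : PowerSeries ℚ) ^ 2 ^ t)) =
      0 := by
  induction n generalizing m with
  | zero =>
    rw [Finset.prod_range_zero, PowerSeries.coeff_one, if_neg (by simp at h; omega)]
  | succ n ih =>
    rw [pow_succ] at h
    rw [Finset.prod_range_succ, mul_sub, mul_one, map_sub, PowerSeries.coeff_mul_X_pow',
      if_pos (by omega), ih (by omega), ih (by omega), sub_zero]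

theorem coeff_fPower_two {n m : ℕ} (h : m < 2 ^ n) :
    PowerSeries.coeff m (fPower 2) =
      PowerSeries.coeff m
        (∏ t ∈ Finset.range n, (1 - (PowerSeries.X : PowerSeries ℚ) ^ 2 ^ t)) := by
  open scoped PowerSeries.WithPiTopology in
  have hlim := ((PowerSeries.WithPiTopology.continuous_coeff ℚ m).tendsto _).comp
    (multipliable_fPower (le_refl 2)).hasProd.tendsto_prod_nat
  refine tendsto_nhds_unique hlim (tendsto_const_nhds.congr' ?_)
  filter_upwards [Filter.eventually_ge_atTop n] with k hk
  induction k, hk using Nat.le_induction with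
  | base => rfl
  | succ k hk ih =>
    have := Nat.pow_le_pow_right (n := 2) (by norm_num) hk
    rw [ih, Function.comp, Function.comp, Finset.prod_range_succ, mul_sub, mul_one, map_sub,
      PowerSeries.coeff_mul_X_pow', if_neg (by omega), sub_zero]

theorem coeff_fPower_two_zero : PowerSeries.coeff 0 (fPower 2) = 1 := by
  rw [coeff_fPower_two (n := 0) (by norm_num)]
  simp

theorem coeff_fPower_two_add {n m : ℕ} (h : m < 2 ^ n) :
    PowerSeries.coeff (2 ^ n + m) (fPower 2) = -PowerSeries.coeff m (fPower 2) := by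
  rw [coeff_fPower_two h, coeff_fPower_two (n := n + 1) (by rw [pow_succ]; omega),
    Finset.prod_range_succ, mul_sub, mul_one, map_sub, PowerSeries.coeff_mul_X_pow',
    if_pos (by omega), coeff_prod_one_sub_X_pow_of_le (by omega), zero_sub, Nat.add_sub_cancel_left]

/-- Removing the leading binary digit of `m` flips the sign. Absolute convergence for `x > 1`
follows. -/
theorem abs_coeff_fPower_two (m : ℕ) : |PowerSeries.coeff m (fPower 2)| = 1 := by
  induction m using Nat.strong_induction_on with
  | _ m ih =>
    rcases Nat.eq_zero_or_pos m with rfl | hm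
    · rw [coeff_fPower_two_zero, abs_one]
    · have h1 := Nat.pow_log_le_self 2 hm.ne'
      have h2 := Nat.lt_pow_succ_log_self (b := 2) (by norm_num) m
      rw [pow_succ] at h2
      have hpos : 0 < 2 ^ Nat.log 2 m := by positivity
      have := coeff_fPower_two_add (n := Nat.log 2 m) (m := m - 2 ^ Nat.log 2 m) (by omega)
      rw [Nat.add_sub_cancel' h1] at this
      rw [this, abs_neg, ih _ (by omega)]

theorem sum_coeff_fPower_two (y : ℝ) (n : ℕ) :
    ∑ m ∈ Finset.range (2 ^ n), ((PowerSeries.coeff m (fPower 2) : ℚ) : ℝ) * y ^ m =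
      ∏ t ∈ Finset.range n, (1 - y ^ 2 ^ t) := by
  induction n with
  | zero => simp [coeff_fPower_two_zero]
  | succ n ih =>
    have : ∑ m ∈ Finset.range (2 ^ n),
        ((PowerSeries.coeff (2 ^ n + m) (fPower 2) : ℚ) : ℝ) * y ^ (2 ^ n + m) =
        -(y ^ 2 ^ n * ∑ m ∈ Finset.range (2 ^ n),
          ((PowerSeries.coeff m (fPower 2) : ℚ) : ℝ) * y ^ m) := by
      rw [Finset.mul_sum, ← Finset.sum_neg_distrib]
      refine Finset.sum_congr rfl fun m hm => ?_
      rw [coeff_fPower_two_add (Finset.mem_range.mp hm), pow_add]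
      push_cast
      ring
    rw [pow_succ, mul_two, Finset.sum_range_add, this, Finset.prod_range_succ, ih]
    ring

/-- The partial sums of length `2 ^ n` are the partial products, so the two limits agree. -/
theorem hasSum_fValue_two {x : ℝ} (hx : 1 < x) :
    HasSum (fun m : ℕ => ((PowerSeries.coeff m (fPower 2) : ℚ) : ℝ) * x⁻¹ ^ m) (fValue 2 x) := by
  have hsum : Summable fun m : ℕ => ((PowerSeries.coeff m (fPower 2) : ℚ) : ℝ) * x⁻¹ ^ m := by
    refine Summable.of_norm_bounded
      (summable_geometric_of_lt_one (by positivity) (inv_lt_one_of_one_lt₀ hx)) fun m => ?_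
    rw [norm_mul, Real.norm_eq_abs, ← Rat.cast_abs, abs_coeff_fPower_two, Rat.cast_one, one_mul,
      Real.norm_of_nonneg (by positivity)]
  have h1 := hsum.hasSum.tendsto_sum_nat.comp (tendsto_pow_atTop_atTop_of_one_lt one_lt_two)
  have h2 := (multipliable_fValue (le_refl 2) hx).hasProd.tendsto_prod_nat
  have h3 : (fun n : ℕ => ∏ t ∈ Finset.range n, (1 - (x ^ 2 ^ t)⁻¹)) =
      (fun n => ∑ m ∈ Finset.range n, ((PowerSeries.coeff m (fPower 2) : ℚ) : ℝ) * x⁻¹ ^ m) ∘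
        fun n => 2 ^ n :=
    funext fun n => by rw [Function.comp, sum_coeff_fPower_two]; simp only [inv_pow]
  rw [h3] at h2
  rw [fValue, ← tendsto_nhds_unique h1 h2]
  exact hsum.hasSum

theorem fValue_two_eq_prod_mul {x : ℝ} (hx : 1 < x) (n : ℕ) :
    fValue 2 x = (∏ t ∈ Finset.range n, (1 - (x ^ 2 ^ t)⁻¹)) * fValue 2 (x ^ 2 ^ n) := by
  have hx' : 1 < x ^ 2 ^ n := one_lt_pow₀ hx (by positivity)
  have h := multipliable_fValue (le_refl 2) hx'
  have hshift (t : ℕ) : (x ^ 2 ^ n) ^ 2 ^ t = x ^ 2 ^ (t + n) := by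
    rw [← pow_mul, ← pow_add, add_comm]
  simp only [fValue, hshift] at h ⊢
  exact (Multipliable.prod_mul_tprod_nat_mul' (f := fun t => 1 - (x ^ 2 ^ t)⁻¹) h).symm

/-! ### Values of Laurent series in `x⁻¹` at real numbers -/

/-- The Laurent series `u` in `x⁻¹` converges at the real number `x` to `s`. -/
def HasValue (x : ℝ) (u : LaurentSeries ℚ) (s : ℝ) : Prop :=
  HasSum (fun i : ℤ => ((u.coeff i : ℚ) : ℝ) * x ^ (-i)) s

theorem HasValue.add {x s r : ℝ} {u v : LaurentSeries ℚ} (hu : HasValue x u s)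
    (hv : HasValue x v r) : HasValue x (u + v) (s + r) := by
  simpa [HasValue, add_mul] using HasSum.add hu hv

theorem HasValue.sub {x s r : ℝ} {u v : LaurentSeries ℚ} (hu : HasValue x u s)
    (hv : HasValue x v r) : HasValue x (u - v) (s - r) := by
  simpa [HasValue, sub_mul] using HasSum.sub hu hv

theorem HasValue.single_mul {x s : ℝ} (hx : x ≠ 0) {u : LaurentSeries ℚ} (hu : HasValue x u s)
    (n : ℤ) (c : ℚ) : HasValue x (HahnSeries.single (-n) c * u) (c * x ^ n * s) := by
  have h := ((Equiv.addRight n).hasSum_iff.mpr hu).mul_left (c * x ^ n)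
  refine (congrArg (HasSum · _) (funext fun i => ?_)).mp h
  rw [HahnSeries.coeff_single_mul, sub_neg_eq_add, Function.comp, Equiv.coe_addRight, neg_add,
    zpow_add₀ hx, zpow_neg x n]
  have := zpow_ne_zero n hx
  push_cast
  field_simp

theorem HasValue.ofPoly_mul {x s : ℝ} (hx : x ≠ 0) {u : LaurentSeries ℚ} (hu : HasValue x u s)
    (Q : ℚ[X]) : HasValue x (ofPoly Q * u) (aeval x Q * s) := by
  induction Q using Polynomial.induction_on' with
  | add P Q hP hQ =>
    rw [ofPoly_add, add_mul, map_add, add_mul]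
    exact hP.add hQ
  | monomial n c =>
    rw [ofPoly_monomial]
    simpa [aeval_monomial] using hu.single_mul hx n c

theorem hasValue_one (x : ℝ) : HasValue x 1 1 := by
  have := hasSum_single (f := fun i : ℤ => (((1 : LaurentSeries ℚ).coeff i : ℚ) : ℝ) * x ^ (-i)) 0
    fun i hi => by simp [HahnSeries.coeff_one, hi]
  simpa [HasValue] using this

theorem hasValue_fSeries_two {x : ℝ} (hx : 1 < x) : HasValue x (fSeries 2) (fValue 2 x) := by
  refine (Function.Injective.hasSum_iff (g := ((↑) : ℕ → ℤ)) Nat.cast_injective ?_).mp ?_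
  · intro i hi
    have : (fSeries 2).coeff i = 0 := by
      rw [fSeries, HahnSeries.ofPowerSeries_apply]
      exact HahnSeries.embDomain_of_notMem_range (by simpa using hi)
    rw [this, Rat.cast_zero, zero_mul]
  · convert hasSum_fValue_two hx using 1
    funext m
    rw [Function.comp, fSeries, HahnSeries.ofPowerSeries_apply_coeff, zpow_neg, zpow_natCast,
      inv_pow]

theorem hasValue_gSeries_two {x : ℝ} (hx : 1 < x) : HasValue x (gSeries 2) (x⁻¹ * fValue 2 x) := by
  have h := (hasValue_fSeries_two hx).single_mul (by positivity) (-1) 1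
  have hinv : xL ^ (-((2 : ℕ) : ℤ) + 1) = HahnSeries.single (- -1) (1 : ℚ) := by
    rw [show -((2 : ℕ) : ℤ) + 1 = -1 by norm_num, zpow_neg_one, xL]
    refine inv_eq_of_mul_eq_one_right ?_
    rw [HahnSeries.single_mul_single]
    simp
  rw [gSeries, hinv]
  simpa using h

/-- A Laurent series in `x⁻¹` that converges at `2` and vanishes to order `d + 1` at infinity is
`O(x ^ (-d - 1))` on `[2, ∞)`. -/
theorem exists_abs_le_of_coeff_eq_zero {u : LaurentSeries ℚ} {s₂ : ℝ} (h2 : HasValue 2 u s₂)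
    {d : ℕ} (hu : ∀ i : ℤ, i ≤ d → u.coeff i = 0) :
    ∃ C : ℝ, 0 ≤ C ∧ ∀ x s : ℝ, 2 ≤ x → HasValue x u s → |s| ≤ C / x ^ (d + 1) := by
  have hsum := h2.summable.abs
  refine ⟨2 ^ (d + 1) * ∑' i : ℤ, |((u.coeff i : ℚ) : ℝ) * 2 ^ (-i)|,
    mul_nonneg (by positivity) (tsum_nonneg fun _ => abs_nonneg _), fun x s hx hs => ?_⟩
  have hx0 : 0 < x := by linarith
  rw [← hs.tsum_eq, mul_comm, mul_div_assoc, ← div_pow, ← tsum_mul_right, ← Real.norm_eq_abs]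
  refine tsum_of_norm_bounded (hsum.mul_right ((2 / x) ^ (d + 1))).hasSum fun i => ?_
  by_cases hi : i ≤ d
  · simp [hu i hi]
  · rw [Real.norm_eq_abs, abs_mul, abs_mul, mul_assoc]
    refine mul_le_mul_of_nonneg_left ?_ (abs_nonneg _)
    -- For `i = d + 1 + k`, `2 ^ k ≤ x ^ k` gives `x ^ (-i) ≤ 2 ^ (-i) (2 / x) ^ (d + 1)`.
    obtain ⟨k, rfl⟩ : ∃ k : ℕ, i = (d + 1 : ℕ) + k := ⟨(i - (d + 1)).toNat, by push_cast; omega⟩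
    rw [abs_of_pos (zpow_pos hx0 _), abs_of_pos (zpow_pos two_pos _), zpow_neg, zpow_neg,
      zpow_add₀ hx0.ne', zpow_add₀ two_ne_zero, zpow_natCast, zpow_natCast, zpow_natCast,
      zpow_natCast, div_pow]
    have : (2 : ℝ) ^ k ≤ x ^ k := pow_le_pow_left₀ (by norm_num) hx k
    calc (x ^ (d + 1) * x ^ k)⁻¹ ≤ (x ^ (d + 1) * 2 ^ k)⁻¹ := by gcongr
      _ = _ := by field_simp

/-- Convergents of `g₂` give good approximations to its values. -/
theorem exists_abs_aeval_mul_sub_le {t : ℕ} {P Q : ℚ[X]} (h : IsConvergent (gSeries 2) t P Q) :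
    ∃ C : ℝ, 0 ≤ C ∧ ∀ x : ℝ, 2 ≤ x →
      |aeval x Q * (x⁻¹ * fValue 2 x) - aeval x P| ≤ C / x ^ (Q.natDegree + 1) := by
  have hval {x : ℝ} (hx : 2 ≤ x) : HasValue x (ofPoly Q * gSeries 2 - ofPoly P)
      (aeval x Q * (x⁻¹ * fValue 2 x) - aeval x P) := by
    refine ((hasValue_gSeries_two (by linarith)).ofPoly_mul (by linarith) Q).sub ?_
    simpa using (hasValue_one x).ofPoly_mul (by linarith) P
  obtain ⟨C, hC, hle⟩ := exists_abs_le_of_coeff_eq_zero (hval le_rfl) fun i => h.coeff_eq_zero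
  exact ⟨C, hC, fun x hx => hle x _ hx (hval hx)⟩

/-! ### Values of `f₂` are not badly approximable -/

theorem exists_abs_eval_le_mul_pow (Q : ℤ[X]) :
    ∃ C : ℝ, 0 < C ∧ ∀ x : ℤ, 1 ≤ x → |((Q.eval x : ℤ) : ℝ)| ≤ C * (x : ℝ) ^ Q.natDegree := by
  refine ⟨∑ i ∈ Finset.range (Q.natDegree + 1), |(Q.coeff i : ℝ)| + 1,
    by positivity, fun x hx => ?_⟩
  have hx1 : (1 : ℝ) ≤ x := by exact_mod_cast hx
  rw [eval_eq_sum_range, Int.cast_sum, add_mul, Finset.sum_mul]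
  refine (Finset.abs_sum_le_sum_abs _ _).trans
    (le_add_of_le_of_nonneg (Finset.sum_le_sum fun i hi => ?_) (by positivity))
  push_cast
  rw [abs_mul, abs_of_nonneg (by positivity : (0 : ℝ) ≤ (x : ℝ) ^ i)]
  exact mul_le_mul_of_nonneg_left
    (pow_le_pow_right₀ hx1 (by simpa [Nat.lt_succ_iff] using hi)) (abs_nonneg _)

theorem prod_one_sub_inv_eq {x : ℝ} (hx : x ≠ 0) (n : ℕ) :
    ∏ t ∈ Finset.range n, (1 - (x ^ 2 ^ t)⁻¹) =
      (∏ t ∈ Finset.range n, (x ^ 2 ^ t - 1)) * x * (x ^ 2 ^ n)⁻¹ := by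
  induction n with
  | zero => simp [hx]
  | succ n ih =>
    rw [Finset.prod_range_succ, ih, Finset.prod_range_succ, pow_succ 2 n, pow_mul]
    field_simp

theorem prod_pow_sub_one_mul_le {x : ℝ} (hx : 1 ≤ x) (n : ℕ) :
    (∏ t ∈ Finset.range n, (x ^ 2 ^ t - 1)) * x ≤ x ^ 2 ^ n := by
  induction n with
  | zero => simp
  | succ n ih =>
    have h1 : 1 ≤ x ^ 2 ^ n := one_le_pow₀ hx
    rw [Finset.prod_range_succ, pow_succ 2 n, pow_mul]
    nlinarith

theorem pow_dvd_prod_pow_sub_one {p a : ℤ} {n₀ : ℕ} (h : p ∣ a ^ 2 ^ n₀ - 1) (e : ℕ) :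
    p ^ e ∣ ∏ t ∈ Finset.range (n₀ + e), (a ^ 2 ^ t - 1) := by
  rw [Finset.prod_range_add]
  refine Dvd.dvd.mul_left ?_ _
  have hconst : p ^ e = ∏ _i ∈ Finset.range e, p := by simp
  rw [hconst]
  refine Finset.prod_dvd_prod_of_dvd _ _ fun i _ => h.trans ?_
  rw [pow_add, pow_mul]
  simpa using sub_dvd_pow_sub_pow (a ^ 2 ^ n₀) 1 (2 ^ i)

/-- If the denominators of a convergent of `g₂` at the points `a ^ 2 ^ n` have unbounded common
factors with `∏_{t < n} (a ^ 2 ^ t - 1)`, then `f₂(a)` is not badly approximable. -/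
theorem not_badlyApproximable_of_forall_exists_dvd {a : ℤ} (ha : 2 ≤ a) {t : ℕ} {P : ℚ[X]}
    {Q : ℤ[X]} (hconv : IsConvergent (gSeries 2) t P (Q.map (Int.castRingHom ℚ))) {p : ℤ}
    (hp : 2 ≤ p)
    (h : ∀ e : ℕ, ∃ n, e ≤ n ∧ p ^ e ∣ ∏ t ∈ Finset.range n, (a ^ 2 ^ t - 1) ∧
      p ^ e ∣ Q.eval (a ^ 2 ^ n)) :
    ¬ BadlyApproximable (fValue 2 a) := by
  rintro ⟨c, hc, hbad⟩
  have hQ0 : Q ≠ 0 := fun h0 => hconv.1 (by rw [h0, Polynomial.map_zero])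
  obtain ⟨C, hC, happrox⟩ := exists_abs_aeval_mul_sub_le hconv
  obtain ⟨C', hC', hQle⟩ := exists_abs_eval_le_mul_pow Q
  -- `P` may have rational coefficients; clearing them costs a factor `D` independent of `n`.
  obtain ⟨D, hD, hP'⟩ := IsLocalization.integerNormalization_spec (nonZeroDivisors ℤ) P
  set P' := IsLocalization.integerNormalization (nonZeroDivisors ℤ) P
  replace hD : D ≠ 0 := nonZeroDivisors.ne_zero hD
  have ha1 : (1 : ℝ) < a := by exact_mod_cast (by omega : 1 < a)
  -- choose the exponent of `p`
  obtain ⟨e, he, hroot⟩ : ∃ e : ℕ, C * C' * D ^ 2 < c * ((p : ℝ) ^ e) ^ 2 ∧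
      ∀ n, e ≤ n → Q.eval (a ^ 2 ^ n) ≠ 0 := by
    have hinj : Function.Injective fun n : ℕ => a ^ 2 ^ n :=
      (pow_right_injective₀ (by omega) (by omega)).comp (Nat.pow_right_injective le_rfl)
    obtain ⟨B, hB⟩ := ((finite_setOfPred_isRoot hQ0).preimage hinj.injOn).bddAbove
    have hlim : Filter.Tendsto (fun e : ℕ => c * ((p : ℝ) ^ e) ^ 2) Filter.atTop Filter.atTop :=
      ((Filter.tendsto_pow_atTop two_ne_zero).comp (tendsto_pow_atTop_atTop_of_one_lt
        (by exact_mod_cast (by omega : 1 < p)))).const_mul_atTop hc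
    obtain ⟨e, he, heB⟩ := ((hlim.eventually_gt_atTop (C * C' * D ^ 2)).and
      (Filter.eventually_gt_atTop B)).exists
    exact ⟨e, he, fun n hn h0 => absurd (hB h0) (by omega)⟩
  obtain ⟨n, hen, ⟨r, hr⟩, ⟨s, hs⟩⟩ := h e
  set x : ℤ := a ^ 2 ^ n with hx
  have hx2 : 2 ≤ x := ha.trans (le_self_pow₀ (by omega) (by positivity))
  have hx2' : (2 : ℝ) ≤ x := by exact_mod_cast hx2
  have hQx : Q.eval x ≠ 0 := hroot n hen
  have hs0 : s ≠ 0 := fun h0 => hQx (by rw [hs, h0, mul_zero])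
  have hpe : (0 : ℝ) < (p : ℝ) ^ e := pow_pos (by exact_mod_cast (by omega : 0 < p)) e
  have hdeg : (Q.map (Int.castRingHom ℚ)).natDegree = Q.natDegree :=
    natDegree_map_eq_of_injective Int.cast_injective Q
  -- This fraction is `A a P(x) / Q(x)` with `p ^ e` cancelled, as `A = p ^ e r` and `Q(x) = p ^ e
  -- s`. Only the bound `c / q ^ 2` is used, not positivity of the distance.
  have hlow := (hbad (a * r * P'.eval x) (D * s) (mul_ne_zero hD hs0)).2
  have hA := happrox x hx2'
  have hevQ : aeval (x : ℝ) (Q.map (Int.castRingHom ℚ)) = (p : ℝ) ^ e * s := by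
    have h1 := congrArg (Int.cast : ℤ → ℝ) hs
    push_cast at h1
    rw [← h1, ← eq_intCast (algebraMap ℤ ℝ) x, ← eq_intCast (algebraMap ℤ ℝ) (Q.eval x),
      ← aeval_algebraMap_apply_eq_algebraMap_eval]
    exact aeval_map_algebraMap ℚ _ Q
  have hevP : (D : ℝ) * aeval (x : ℝ) P = (P'.eval x : ℤ) := by
    have h1 := congrArg (aeval (x : ℝ)) hP'
    rw [aeval_map_algebraMap, map_zsmul, zsmul_eq_mul] at h1
    rw [← h1, ← eq_intCast (algebraMap ℤ ℝ) x, aeval_algebraMap_apply_eq_algebraMap_eval,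
      eq_intCast]
  set A : ℝ := ∏ t ∈ Finset.range n, ((a : ℝ) ^ 2 ^ t - 1) with hAdef
  have hAr : A = (p : ℝ) ^ e * r := by
    rw [hAdef]
    exact_mod_cast congrArg (Int.cast : ℤ → ℝ) hr
  have hxa : (x : ℝ) = (a : ℝ) ^ 2 ^ n := by rw [hx]; push_cast; rfl
  have hA0 : 0 ≤ A := Finset.prod_nonneg fun i _ => sub_nonneg.mpr (one_le_pow₀ ha1.le)
  have hAx : A * a ≤ x := hxa ▸ prod_pow_sub_one_mul_le ha1.le n
  have hf : fValue 2 (a : ℝ) = A * a * ((x : ℝ)⁻¹ * fValue 2 x) := by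
    rw [fValue_two_eq_prod_mul ha1 n, prod_one_sub_inv_eq (by positivity), hxa]
    ring
  have hD' : (D : ℝ) ≠ 0 := Int.cast_ne_zero.mpr hD
  have hs' : (s : ℝ) ≠ 0 := Int.cast_ne_zero.mpr hs0
  have hx0 : (0 : ℝ) < x := by linarith
  have herr : fValue 2 (a : ℝ) - ((a * r * P'.eval x : ℤ) : ℝ) / ((D * s : ℤ) : ℝ) =
      A * a * ((p : ℝ) ^ e * s * ((x : ℝ)⁻¹ * fValue 2 x) - aeval (x : ℝ) P) /
        ((p : ℝ) ^ e * s) := by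
    push_cast
    rw [hf, ← hevP, hAr]
    field_simp
  rw [hevQ, hdeg] at hA
  have hQle' := hQle x (by omega)
  rw [hs] at hQle'
  push_cast at hQle'
  rw [herr, abs_div, abs_mul, abs_of_nonneg (mul_nonneg hA0 (by linarith))] at hlow
  set q : ℝ := |(p : ℝ) ^ e * s| with hq
  have hqpos : 0 < q := abs_pos.mpr (mul_ne_zero hpe.ne' hs')
  have hup : c / ((D * s : ℤ) : ℝ) ^ 2 ≤ C * C' / q ^ 2 :=
    calc c / ((D * s : ℤ) : ℝ) ^ 2 ≤ x * (C / (x : ℝ) ^ (Q.natDegree + 1)) / q :=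
          hlow.trans (by gcongr)
      _ = C / (x : ℝ) ^ Q.natDegree / q := by rw [pow_succ]; field_simp
      _ ≤ C * C' / q / q := by
          gcongr ?_ / q
          rw [div_le_div_iff₀ (by positivity) hqpos, mul_assoc]
          exact mul_le_mul_of_nonneg_left hQle' hC
      _ = C * C' / q ^ 2 := by rw [div_div, sq]
  rw [hq, sq_abs, div_le_div_iff₀ (by push_cast; positivity) (by positivity)] at hup
  push_cast at hup
  have hs2 : (0 : ℝ) < (s : ℝ) ^ 2 := by positivity
  have := mul_lt_mul_of_pos_right he hs2
  linarith [this, hup, mul_pow ((p : ℝ) ^ e) (s : ℝ) 2, mul_pow (D : ℝ) (s : ℝ) 2]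

end ThueMorse

theorem theorem4 (a : ℤ) (ha : 2 ≤ a) (p n₀ t : ℕ) (P : ℚ[X]) (Q : ℤ[X])
    (hp : p.Prime) (hodd : Odd p)
    (hconv : ThueMorse.IsConvergent (ThueMorse.gSeries 2) t
      P (Q.map (Int.castRingHom ℚ)))
    (h1 : (p : ℤ) ∣ a ^ 2 ^ n₀ - 1 ∧ ¬ (p : ℤ) ^ 2 ∣ a ^ 2 ^ n₀ - 1)
    (h2 : Nat.card (ThueMorse.Gam 2 (p ^ 2)) = p * Nat.card (ThueMorse.Gam 2 p))
    (h3 : (p : ℤ) ^ 2 ∣ Q.eval (a ^ 2 ^ n₀))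
    (h4 : ¬ (p : ℤ) ∣ Q.derivative.eval 1) :
    ¬ ThueMorse.BadlyApproximable (ThueMorse.fValue 2 (a : ℝ)) := by
  refine ThueMorse.not_badlyApproximable_of_forall_exists_dvd ha hconv (p := p)
    (by exact_mod_cast hp.two_le) fun e => ?_
  obtain ⟨k, hk, hdvd⟩ := ThueMorse.exists_dvd_eval_pow_two_pow_of_le hp hodd
    (ThueMorse.not_sq_dvd_two_pow_sub_one hp hodd h2) h4 h1.1 h1.2 h3 e
  refine ⟨n₀ + k, by omega, (pow_dvd_pow _ hk).trans
    (ThueMorse.pow_dvd_prod_pow_sub_one h1.1 k), ?_⟩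
  rw [pow_add 2, pow_mul]
  exact (pow_dvd_pow _ (by omega)).trans hdvd
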